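/- Let $N$ tasks be given. Task $i$ is a Markov decision process with finite state set $\mathcal S_i$, finite nonempty action set $\mathcal A_i$, transition probabilities $\mathcal P_i(s'\mid s,a)$ and real reward function $\mathcal R_i(s,a)$. Let $\gamma\in[0,1)$ be the discount factor, $\lambda\ge 0$ the personalization weight, $Q_i^{\pi}:\mathcal S_i\times\mathcal A_i\to\mathbb R$ a fixed (meta) Q-table for each task, and let the learning rates $\eta^k\ge 0$ satisfy $\sum_k\eta^k=\infty$ and $\sum_k(\eta^k)^2<\infty$. Starting from arbitrary tables $Q_{i,0}$ and $\widetilde Q_{i,0}$, consider the exact iteration $$Q_{i,k+1}(s,a)=Q_{i,k}(s,a)+\eta^k\Big[\mathcal R_i(s,a)+\gamma\,\mathbb E_{s'\sim\mathcal P_i(\cdot\mid s,a)}\max_{a'}Q_{i,k}(s',a')-Q_{i,k}(s,a)\Big]-\frac{\eta^k\lambda}{2}\cdot 2\big(Q_{i,k}(s,a)-Q_i^{\pi}(s,a)\big)$$ and the sampled iteration $$\widetilde Q_{i,k+1}(s,a)=\widetilde Q_{i,k}(s,a)+\eta^k\Big[\mathcal R_i(s,a)+\gamma\max_{a'}\widetilde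 Q_{i,k}(s'_{i,k}(s,a),a')-\widetilde Q_{i,k}(s,a)\Big]-\frac{\eta^k\lambda}{2}\cdot 2\big(\widetilde Q_{i,k}(s,a)-Q_i^{\pi}(s,a)\big),$$ where each $s'_{i,k}(s,a)$ is a random state, known at time $k+1$ of a filtration $(\mathcal F_k)$, whose conditional law given the past $\mathcal F_k$ is $\mathcal P_i(\cdot\mid s,a)$. Let $$\hat{\mathcal B}_iQ(s,a)=\frac{\lambda}{1+\lambda}Q_i^{\pi}(s,a)+\frac1{1+\lambda}\Big(\mathcal R_i(s,a)+\gamma\,\mathbb E_{s'\sim\mathcal P_i(\cdot\mid s,a)}\max_{a'}Q(s',a')\Big).$$ Then: 1. For every task $i$ and all tables $Q^1,Q^2$, $\|\hat{\mathcal B}_iQ^1-\hat{\mathcal B}_iQ^2\|_\infty\le\frac{\gamma}{1+\lambda}\|Q^1-Q^2\|_\infty$. 2. Each $\hat{\mathcal B}_i$ has exactly one fixed point $Q_i^*$, and almost surely $\widetilde Q_{i,k}\to Q_i^*$ as $k\to\infty$ for every $i$. 3. Almost surely, for every $\delta>0$ there is $K_0$ such that for all $K\ge K_0$ $$\big|Q_{i,K}(s,a)-\widetilde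 Q_{i,K}(s,a)\big|\le\delta\qquad\text{for all } i,\ s\in\mathcal S_i,\ a\in\mathcal A_i.$$ -/

import Mathlib

open MeasureTheory Filter Topology

/-- A finite Markov decision process without its discount factor: transition probabilities
`P s a s'` and a reward function `R`. (On finite state and action spaces the reward is
automatically bounded.) -/
structure FiniteMDP (S A : Type*) [Fintype S] where
  P : S → A → S → ℝ
  P_nonneg : ∀ s a s', 0 ≤ P s a s'
  P_sum_eq_one : ∀ s a, ∑ s', P s a s' = 1
  R : S → A → ℝ

/-- `max_{a'} Q(s, a')`. -/
noncomputable def maxAction {S A : Type*} [Fintype A] [Nonempty A]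
    (Q : S → A → ℝ) (s : S) : ℝ :=
  Finset.univ.sup' Finset.univ_nonempty (fun a => Q s a)

/-- The Bellman optimality operator
`Q ↦ R(s, a) + γ E_{s' ∼ P(· | s, a)} [max_{a'} Q(s', a')]`. -/
noncomputable def bellman {S A : Type*} [Fintype S] [Fintype A] [Nonempty A]
    (M : FiniteMDP S A) (γ : ℝ) (Q : S → A → ℝ) : S → A → ℝ :=
  fun s a => M.R s a + γ * ∑ s', M.P s a s' * maxAction Q s'

/-- The regularized Bellman operator
`Q ↦ λ/(1+λ) Qmeta + 1/(1+λ) (R + γ E [max Q])`. -/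
noncomputable def regBellman {S A : Type*} [Fintype S] [Fintype A] [Nonempty A]
    (M : FiniteMDP S A) (γ lam : ℝ) (Qmeta : S → A → ℝ) (Q : S → A → ℝ) : S → A → ℝ :=
  fun s a => lam / (1 + lam) * Qmeta s a + 1 / (1 + lam) * bellman M γ Q s a

/-- The gradient at `Q` of the personalization penalty `φ(Q, Qmeta) = (Q - Qmeta)²`, for every
state and action. -/
def penaltyGrad {S A : Type*} (Q Qmeta : S → A → ℝ) : S → A → ℝ :=
  fun s a => 2 * (Q s a - Qmeta s a)

/-- The exact personalized Q-iteration: gradient descent steps with step sizes `η k`, in which the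
expectation over the next state is computed exactly. -/
noncomputable def exactQ {S A : Type*} [Fintype S] [Fintype A] [Nonempty A]
    (M : FiniteMDP S A) (γ lam : ℝ) (η : ℕ → ℝ) (Qmeta Q₀ : S → A → ℝ) : ℕ → S → A → ℝ
  | 0 => Q₀
  | k + 1 => fun s a =>
      let Q := exactQ M γ lam η Qmeta Q₀ k
      Q s a
        + η k * (M.R s a + γ * ∑ s', M.P s a s' * maxAction Q s' - Q s a)
        - η k * lam / 2 * penaltyGrad Q Qmeta s a

/-- The sampled personalized Q-iteration: the expectation over the next state is replaced, in
step `k`, by the value at the sampled next state `x k s a`. -/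
noncomputable def sampledQ {S A : Type*} [Fintype S] [Fintype A] [Nonempty A]
    (M : FiniteMDP S A) (γ lam : ℝ) (η : ℕ → ℝ) (Qmeta Q₀ : S → A → ℝ)
    (x : ℕ → S → A → S) : ℕ → S → A → ℝ
  | 0 => Q₀
  | k + 1 => fun s a =>
      let Q := sampledQ M γ lam η Qmeta Q₀ x k
      Q s a
        + η k * (M.R s a + γ * maxAction Q (x k s a) - Q s a)
        - η k * lam / 2 * penaltyGrad Q Qmeta s a

/-- `X k ω s a` is the next state sampled in step `k` for the pair `(s, a)`: it is revealed between
the times `k` and `k + 1` of the filtration `ℱ`, and given the past `ℱ k` it has the transition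
law `M.P s a`. -/
structure IsTransitionSampling {Ω : Type*} {mΩ : MeasurableSpace Ω} (μ : Measure Ω)
    (ℱ : Filtration ℕ mΩ) {S A : Type*} [Fintype S] (M : FiniteMDP S A)
    (X : ℕ → Ω → S → A → S) : Prop where
  measurable : ∀ k s a s', MeasurableSet[ℱ (k + 1)] {ω | X k ω s a = s'}
  law : ∀ k s a s',
    μ[Set.indicator {ω | X k ω s a = s'} (fun _ => (1 : ℝ)) | ℱ k] =ᵐ[μ] fun _ => M.P s a s'

/-! Put `αₖ = (1 + λ) ηₖ`. Both iterations are relaxations `Qₖ₊₁ = Qₖ + αₖ • (Gₖ - Qₖ)`: for the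
exact one `Gₖ = B̂ Qₖ`, and for the sampled one `Gₖ = B̂ₖ Qₖ`, where `B̂ₖ` is the regularized
Bellman operator of the deterministic process that jumps to the states observed in step `k`. All
these operators contract with the same factor `|γ| / (1 + λ)`, so the sampled tables are bounded by
a constant that does not depend on the samples, and the noise terms `αₖ • (B̂ₖ Qₖ - B̂ Qₖ)` are
martingale differences with square-summable bounds. Their series therefore converges almost surely.
Relaxing the noise alone then gives a null sequence `vₖ`, and `‖Qₖ - Q* - vₖ‖` satisfies a
contracting recursion, so it tends to zero as well. -/

section Relaxation

variable {α : ℕ → ℝ}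

theorem eventually_lt_of_le_one_sub_mul {z : ℕ → ℝ} (hα₀ : ∀ k, 0 ≤ α k)
    (hα₁ : ∀ᶠ k in atTop, α k ≤ 1) (hα : ¬ Summable α)
    (hz : ∀ᶠ k in atTop, z (k + 1) ≤ (1 - α k) * z k) {δ : ℝ} (hδ : 0 < δ) :
    ∀ᶠ k in atTop, z k < δ := by
  obtain ⟨K, hK⟩ := eventually_atTop.1 (hα₁.and hz)
  have hbound : ∀ n, K ≤ n → z n ≤ |z K| * Real.exp (-∑ j ∈ Finset.Ico K n, α j) := by
    intro n hn
    have hfactor : ∀ j ∈ Finset.Ico K n, 0 ≤ 1 - α j := fun j hj =>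
      sub_nonneg.2 (hK j (Finset.mem_Ico.1 hj).1).1
    calc z n ≤ z K * ∏ j ∈ Finset.Ico K n, (1 - α j) := by
          simpa using discrete_gronwall_prod_general (b := fun _ => 0)
            (fun j hj => by simpa using (hK j hj).2) (fun j hj => sub_nonneg.2 (hK j hj).1) hn
      _ ≤ |z K| * ∏ j ∈ Finset.Ico K n, (1 - α j) :=
          mul_le_mul_of_nonneg_right (le_abs_self _) (Finset.prod_nonneg hfactor)
      _ ≤ |z K| * Real.exp (-∑ j ∈ Finset.Ico K n, α j) := by
          rw [← Finset.sum_neg_distrib, Real.exp_sum]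
          gcongr
          · exact hfactor
          · exact Real.one_sub_le_exp_neg _
  have hsum : Tendsto (fun n => ∑ j ∈ Finset.Ico K n, α j) atTop atTop := by
    refine (tendsto_atTop_add_const_right atTop (-∑ j ∈ Finset.range K, α j)
      ((not_summable_iff_tendsto_nat_atTop_of_nonneg hα₀).1 hα)).congr' ?_
    filter_upwards [eventually_ge_atTop K] with n hn
    rw [Finset.sum_Ico_eq_sub _ hn, sub_eq_add_neg]
  have hlim : Tendsto (fun n => |z K| * Real.exp (-∑ j ∈ Finset.Ico K n, α j)) atTop (𝓝 0) := by
    simpa using (Real.tendsto_exp_neg_atTop_nhds_zero.comp hsum).const_mul |z K|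
  filter_upwards [eventually_ge_atTop K, hlim.eventually (gt_mem_nhds hδ)] with n hn hlt
  exact (hbound n hn).trans_lt hlt

theorem tendsto_zero_of_le_one_sub_mul_add {x ε : ℕ → ℝ} (hx : ∀ k, 0 ≤ x k)
    (hα₀ : ∀ k, 0 ≤ α k) (hα₁ : ∀ᶠ k in atTop, α k ≤ 1) (hα : ¬ Summable α)
    (hε : Tendsto ε atTop (𝓝 0))
    (h : ∀ᶠ k in atTop, x (k + 1) ≤ (1 - α k) * x k + α k * ε k) :
    Tendsto x atTop (𝓝 0) := by
  refine tendsto_order.2 ⟨fun δ hδ => .of_forall fun k => hδ.trans_le (hx k), fun δ hδ => ?_⟩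
  have hexcess : ∀ᶠ k in atTop, x (k + 1) - δ / 2 ≤ (1 - α k) * (x k - δ / 2) := by
    filter_upwards [h, hε.eventually (gt_mem_nhds (half_pos hδ))] with k hk hεk
    linarith [mul_le_mul_of_nonneg_left hεk.le (hα₀ k)]
  filter_upwards [eventually_lt_of_le_one_sub_mul (z := fun k => x k - δ / 2) hα₀ hα₁ hα hexcess
    (half_pos hδ)] with k hk
  linarith

theorem le_max_mul_exp_sum_sq {y : ℕ → ℝ} (hy₀ : ∀ k, 0 ≤ y k) (hα₀ : ∀ k, 0 ≤ α k) {c C : ℝ}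
    (hc₀ : 0 ≤ c) (hc₁ : c < 1)
    (hy : ∀ k, y (k + 1) ≤ |1 - α k| * y k + α k * (C + c * y k)) (n : ℕ) :
    y n ≤ max (y 0) (C / (1 - c)) * Real.exp (∑ k ∈ Finset.range n, α k ^ 2) := by
  set D : ℕ → ℝ := fun k => max (y k) (C / (1 - c))
  have hD₀ : ∀ k, 0 ≤ D k := fun k => (hy₀ k).trans (le_max_left _ _)
  have haffine : ∀ k, C + c * y k ≤ D k := fun k => by
    have hC : C ≤ D k * (1 - c) := (div_le_iff₀ (sub_pos.2 hc₁)).1 (le_max_right _ _)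
    linarith [mul_le_mul_of_nonneg_left (le_max_left (y k) (C / (1 - c))) hc₀]
  -- A step with `1 < α k` is no convex combination, but its excess is of second order in `α k`.
  have hfactor : ∀ k, |1 - α k| + α k ≤ 1 + α k ^ 2 := fun k => by
    rcases abs_cases (1 - α k) with ⟨h, -⟩ | ⟨h, -⟩ <;> nlinarith [sq_nonneg (α k - 1)]
  have hD : ∀ k ≥ 0, D (k + 1) ≤ (1 + α k ^ 2) * D k + 0 := fun k _ => by
    rw [add_zero]
    refine max_le ?_ ((le_max_right _ _).trans
      (le_mul_of_one_le_left (hD₀ k) (le_add_of_nonneg_right (sq_nonneg _))))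
    calc y (k + 1) ≤ |1 - α k| * y k + α k * (C + c * y k) := hy k
      _ ≤ |1 - α k| * D k + α k * D k :=
          add_le_add (mul_le_mul_of_nonneg_left (le_max_left _ _) (abs_nonneg _))
            (mul_le_mul_of_nonneg_left (haffine k) (hα₀ k))
      _ = (|1 - α k| + α k) * D k := (add_mul _ _ _).symm
      _ ≤ (1 + α k ^ 2) * D k := mul_le_mul_of_nonneg_right (hfactor k) (hD₀ k)
  have hgronwall := discrete_gronwall (n₀ := 0) (c := fun k => α k ^ 2) (b := fun _ => 0)
    (hD₀ 0) hD (fun _ _ => sq_nonneg _) (fun _ _ => le_rfl) n.zero_le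
  calc y n ≤ D n := le_max_left _ _
    _ ≤ D 0 * Real.exp (∑ k ∈ Finset.range n, α k ^ 2) := by
        simpa using hgronwall

section NormedSpace

variable {E : Type*} [NormedAddCommGroup E] [NormedSpace ℝ E]

theorem norm_add_smul_sub_le (t : ℝ) (x y : E) :
    ‖x + t • (y - x)‖ ≤ |1 - t| * ‖x‖ + |t| * ‖y‖ := by
  have h : x + t • (y - x) = (1 - t) • x + t • y := by module
  rw [h, ← Real.norm_eq_abs, ← Real.norm_eq_abs, ← norm_smul, ← norm_smul]
  exact norm_add_le _ _

theorem norm_add_smul_sub_le_of_mem_Icc {t : ℝ} (ht₀ : 0 ≤ t) (ht₁ : t ≤ 1) (x y : E) :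
    ‖x + t • (y - x)‖ ≤ (1 - t) * ‖x‖ + t * ‖y‖ := by
  simpa [abs_of_nonneg ht₀, abs_of_nonneg (sub_nonneg.2 ht₁)] using norm_add_smul_sub_le t x y

theorem tendsto_zero_of_relaxation {v ε : ℕ → E} (hα₀ : ∀ k, 0 ≤ α k)
    (hα₁ : ∀ᶠ k in atTop, α k ≤ 1) (hα : ¬ Summable α) (hε : Tendsto ε atTop (𝓝 0))
    (hv : ∀ k, v (k + 1) = v k + α k • (ε k - v k)) : Tendsto v atTop (𝓝 0) := by
  rw [tendsto_zero_iff_norm_tendsto_zero] at hε ⊢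
  refine tendsto_zero_of_le_one_sub_mul_add (fun _ => norm_nonneg _) hα₀ hα₁ hα hε ?_
  filter_upwards [hα₁] with k hk
  rw [hv]
  exact norm_add_smul_sub_le_of_mem_Icc (hα₀ k) hk _ _

theorem tendsto_zero_of_relaxation_of_tendsto_sum {v w : ℕ → E} {L : E} (hα₀ : ∀ k, 0 ≤ α k)
    (hα₁ : ∀ᶠ k in atTop, α k ≤ 1) (hα : ¬ Summable α)
    (hw : Tendsto (fun n => ∑ k ∈ Finset.range n, α k • w k) atTop (𝓝 L))
    (hv : ∀ k, v (k + 1) = v k + α k • (w k - v k)) : Tendsto v atTop (𝓝 0) := by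
  set T : ℕ → E := fun n => L - ∑ k ∈ Finset.range n, α k • w k with hT
  have hT₀ : Tendsto T atTop (𝓝 0) := by simpa using hw.const_sub L
  -- Adding the tail `T` absorbs the noise: `v + T` is the relaxation of `T` itself.
  have hvT : Tendsto (fun k => v k + T k) atTop (𝓝 0) := by
    refine tendsto_zero_of_relaxation hα₀ hα₁ hα hT₀ fun k => ?_
    simp only [hv, hT, Finset.sum_range_succ]
    module
  simpa using hvT.sub hT₀

theorem tendsto_of_relaxation_of_contracting {F : E → E} {q : E} {c : ℝ} (hc₀ : 0 ≤ c)
    (hc₁ : c < 1) (hF : ∀ x, ‖F x - q‖ ≤ c * ‖x - q‖) (hα₀ : ∀ k, 0 ≤ α k)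
    (hα₁ : ∀ᶠ k in atTop, α k ≤ 1) (hα : ¬ Summable α) {Y G : ℕ → E} {L : E}
    (hY : ∀ k, Y (k + 1) = Y k + α k • (G k - Y k))
    (hnoise : Tendsto (fun n => ∑ k ∈ Finset.range n, α k • (G k - F (Y k))) atTop (𝓝 L)) :
    Tendsto Y atTop (𝓝 q) := by
  let v : ℕ → E := Nat.rec 0 fun k v => v + α k • (G k - F (Y k) - v)
  have hv₀ : Tendsto v atTop (𝓝 0) :=
    tendsto_zero_of_relaxation_of_tendsto_sum hα₀ hα₁ hα hnoise fun _ => rfl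
  set Z : ℕ → E := fun k => Y k - q - v k with hZ
  have hZ_succ : ∀ k, Z (k + 1) = Z k + α k • (F (Y k) - q - Z k) := fun k => by
    have hvk : v (k + 1) = v k + α k • (G k - F (Y k) - v k) := rfl
    simp only [hZ, hY, hvk]
    module
  have hFY : ∀ k, ‖F (Y k) - q‖ ≤ c * (‖Z k‖ + ‖v k‖) := fun k => by
    have hYZ : Y k - q = Z k + v k := (sub_add_cancel _ _).symm
    exact (hF _).trans (mul_le_mul_of_nonneg_left (hYZ ▸ norm_add_le _ _) hc₀)
  have hc : 0 < 1 - c := sub_pos.2 hc₁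
  have hZ₀ : Tendsto Z atTop (𝓝 0) := by
    rw [tendsto_zero_iff_norm_tendsto_zero]
    refine tendsto_zero_of_le_one_sub_mul_add (α := fun k => (1 - c) * α k)
      (ε := fun k => c / (1 - c) * ‖v k‖) (fun _ => norm_nonneg _)
      (fun k => mul_nonneg hc.le (hα₀ k)) ?_ ((summable_mul_left_iff hc.ne').not.2 hα)
      (by simpa using hv₀.norm.const_mul (c / (1 - c))) ?_
    · filter_upwards [hα₁] with k hk
      nlinarith [hα₀ k]
    · filter_upwards [hα₁] with k hk
      calc ‖Z (k + 1)‖ ≤ (1 - α k) * ‖Z k‖ + α k * ‖F (Y k) - q‖ :=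
            hZ_succ k ▸ norm_add_smul_sub_le_of_mem_Icc (hα₀ k) hk _ _
        _ ≤ (1 - α k) * ‖Z k‖ + α k * (c * (‖Z k‖ + ‖v k‖)) := by
            gcongr
            exacts [hα₀ k, hFY k]
        _ = (1 - (1 - c) * α k) * ‖Z k‖ + (1 - c) * α k * (c / (1 - c) * ‖v k‖) := by
            field_simp
            ring
  simpa [hZ] using (hZ₀.add hv₀).add_const q

end NormedSpace

end Relaxation

section MartingaleDifference

variable {Ω : Type*} {m mΩ : MeasurableSpace Ω} {μ : Measure Ω}

theorem integral_mul_eq_zero_of_condExp_eq_zero (hm : m ≤ mΩ) [SigmaFinite (μ.trim hm)]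
    {f g : Ω → ℝ} (hf : StronglyMeasurable[m] f) (hfg : Integrable (f * g) μ)
    (hg : Integrable g μ) (hg₀ : μ[g | m] =ᵐ[μ] 0) : ∫ ω, f ω * g ω ∂μ = 0 := by
  have hcond : μ[f * g | m] =ᵐ[μ] 0 := by
    filter_upwards [condExp_mul_of_stronglyMeasurable_left hf hfg hg, hg₀] with ω hpull hzero
    simp [hpull, hzero]
  calc ∫ ω, f ω * g ω ∂μ = ∫ ω, (μ[f * g | m]) ω ∂μ := (integral_condExp hm).symm
    _ = 0 := by simpa using integral_congr_ae hcond

variable [IsFiniteMeasure μ] {ℱ : Filtration ℕ mΩ} {d : ℕ → Ω → ℝ}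

theorem stronglyMeasurable_sum_range_of_succ
    (hd : ∀ k, StronglyMeasurable[ℱ (k + 1)] (d k)) (n : ℕ) :
    StronglyMeasurable[ℱ n] fun ω => ∑ k ∈ Finset.range n, d k ω :=
  Finset.stronglyMeasurable_fun_sum _ fun _ hk =>
    (hd _).mono (ℱ.mono (Finset.mem_range.1 hk))

theorem martingale_sum_range_of_condExp_eq_zero
    (hd : ∀ k, StronglyMeasurable[ℱ (k + 1)] (d k)) (hdi : ∀ k, Integrable (d k) μ)
    (hd₀ : ∀ k, μ[d k | ℱ k] =ᵐ[μ] 0) :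
    Martingale (fun n ω => ∑ k ∈ Finset.range n, d k ω) ℱ μ := by
  refine martingale_of_condExp_sub_eq_zero_nat (stronglyMeasurable_sum_range_of_succ hd)
    (fun n => integrable_finsetSum _ fun k _ => hdi k) fun n => ?_
  have hincr : (fun ω => ∑ k ∈ Finset.range (n + 1), d k ω)
      - (fun ω => ∑ k ∈ Finset.range n, d k ω) = d n := by
    funext ω
    simp [Finset.sum_range_succ]
  rw [hincr]
  exact hd₀ n

theorem integral_sum_range_sq_of_condExp_eq_zero
    (hd : ∀ k, StronglyMeasurable[ℱ (k + 1)] (d k)) (hd2 : ∀ k, MemLp (d k) 2 μ)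
    (hd₀ : ∀ k, μ[d k | ℱ k] =ᵐ[μ] 0) (n : ℕ) :
    ∫ ω, (∑ k ∈ Finset.range n, d k ω) ^ 2 ∂μ = ∑ k ∈ Finset.range n, ∫ ω, d k ω ^ 2 ∂μ := by
  induction n with
  | zero => simp
  | succ n ih =>
    set f : Ω → ℝ := fun ω => ∑ k ∈ Finset.range n, d k ω
    have hf2 : MemLp f 2 μ := memLp_finsetSum _ fun k _ => hd2 k
    have hfd : Integrable (fun ω => f ω * d n ω) μ := hf2.integrable_mul (hd2 n)
    have horth : ∫ ω, f ω * d n ω ∂μ = 0 :=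
      integral_mul_eq_zero_of_condExp_eq_zero (ℱ.le n) (stronglyMeasurable_sum_range_of_succ hd n)
        hfd ((hd2 n).integrable one_le_two) (hd₀ n)
    have hexpand : ∀ ω, (∑ k ∈ Finset.range (n + 1), d k ω) ^ 2 =
        f ω ^ 2 + 2 * (f ω * d n ω) + d n ω ^ 2 := fun ω => by
      rw [Finset.sum_range_succ]
      ring
    have hcross : Integrable (fun ω => f ω ^ 2 + 2 * (f ω * d n ω)) μ :=
      hf2.integrable_sq.add (hfd.const_mul 2)
    simp only [hexpand]
    rw [integral_add hcross (hd2 n).integrable_sq, integral_add hf2.integrable_sq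
      (hfd.const_mul 2), integral_const_mul, horth, Finset.sum_range_succ, ih, mul_zero, add_zero]

theorem eLpNorm_one_le_of_integral_sq_le {f : Ω → ℝ} (hf : MemLp f 2 μ) {b : ℝ}
    (hb : ∫ ω, f ω ^ 2 ∂μ ≤ b) : eLpNorm f 1 μ ≤ ENNReal.ofReal (μ.real Set.univ + b) := by
  have hfi : Integrable f μ := hf.integrable one_le_two
  rw [eLpNorm_one_eq_lintegral_enorm, ← ofReal_integral_norm_eq_lintegral_enorm hfi]
  refine ENNReal.ofReal_le_ofReal ?_
  calc ∫ ω, ‖f ω‖ ∂μ ≤ ∫ ω, (1 + f ω ^ 2) ∂μ := by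
        refine integral_mono hfi.norm ((integrable_const _).add hf.integrable_sq) fun ω => ?_
        simp only [Real.norm_eq_abs]
        nlinarith [sq_abs (f ω), sq_nonneg (|f ω| - 1)]
    _ = μ.real Set.univ + ∫ ω, f ω ^ 2 ∂μ := by
        rw [integral_add (integrable_const _) hf.integrable_sq]
        simp
    _ ≤ μ.real Set.univ + b := by gcongr

theorem ae_exists_tendsto_sum_of_condExp_eq_zero
    (hd : ∀ k, StronglyMeasurable[ℱ (k + 1)] (d k)) (hd2 : ∀ k, MemLp (d k) 2 μ)
    (hsum : Summable fun k => ∫ ω, d k ω ^ 2 ∂μ) (hd₀ : ∀ k, μ[d k | ℱ k] =ᵐ[μ] 0) :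
    ∀ᵐ ω ∂μ, ∃ l, Tendsto (fun n => ∑ k ∈ Finset.range n, d k ω) atTop (𝓝 l) := by
  refine (martingale_sum_range_of_condExp_eq_zero hd (fun k => (hd2 k).integrable one_le_two)
    hd₀).submartingale.exists_ae_tendsto_of_bdd
    (R := (μ.real Set.univ + ∑' k, ∫ ω, d k ω ^ 2 ∂μ).toNNReal) fun n => ?_
  refine eLpNorm_one_le_of_integral_sq_le (memLp_finsetSum _ fun k _ => hd2 k) ?_
  rw [integral_sum_range_sq_of_condExp_eq_zero hd hd2 hd₀]
  exact hsum.sum_le_tsum _ fun k _ => integral_nonneg fun ω => sq_nonneg _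

end MartingaleDifference

section RandomState

variable {Ω S : Type*} {m mΩ : MeasurableSpace Ω} {μ : Measure Ω} {Y : Ω → S} {V : Ω → S → ℝ}

theorem measurable_apply_of_measurableSet_fiber [Countable S]
    (hY : ∀ s, MeasurableSet[m] {ω | Y ω = s}) (hV : ∀ s, Measurable[m] fun ω => V ω s) :
    Measurable[m] fun ω => V ω (Y ω) := by
  let : MeasurableSpace S := ⊤
  have hVm : Measurable (Function.uncurry V) := measurable_from_prod_countable_left hV
  exact hVm.comp (measurable_id.prodMk (measurable_to_countable' hY))

variable [Fintype S]

theorem apply_eq_sum_mul_indicator (Y : Ω → S) (V : Ω → S → ℝ) :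
    (fun ω => V ω (Y ω)) =
      ∑ s, (fun ω => V ω s) * Set.indicator {ω | Y ω = s} (fun _ => (1 : ℝ)) := by
  classical
  funext ω
  simp [Set.indicator_apply]

theorem condExp_apply_of_condExp_indicator [IsFiniteMeasure μ]
    (hY : ∀ s, MeasurableSet {ω | Y ω = s}) {p : S → ℝ}
    (hp : ∀ s, μ[Set.indicator {ω | Y ω = s} (fun _ => (1 : ℝ)) | m] =ᵐ[μ] fun _ => p s)
    (hV : ∀ s, StronglyMeasurable[m] fun ω => V ω s) (hVi : ∀ s, Integrable (fun ω => V ω s) μ) :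
    μ[fun ω => V ω (Y ω) | m] =ᵐ[μ] fun ω => ∑ s, p s * V ω s := by
  set I : S → Ω → ℝ := fun s => Set.indicator {ω | Y ω = s} fun _ => 1
  have hI : ∀ s, Integrable (I s) μ := fun s => (integrable_const 1).indicator (hY s)
  have hVI : ∀ s, Integrable ((fun ω => V ω s) * I s) μ := fun s => by
    refine ((hVi s).indicator (hY s)).congr (.of_forall fun ω => ?_)
    by_cases hω : Y ω = s <;> simp [I, hω]
  have hpull : ∀ s, μ[(fun ω => V ω s) * I s | m] =ᵐ[μ] fun ω => p s * V ω s := fun s => by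
    filter_upwards [condExp_mul_of_stronglyMeasurable_left (hV s) (hVI s) (hI s), hp s]
      with ω hω hpω
    rw [hω, Pi.mul_apply, hpω, mul_comm]
  rw [apply_eq_sum_mul_indicator]
  filter_upwards [condExp_finsetSum (fun s _ => hVI s) m, ae_all_iff.2 hpull] with ω hsum hω
  rw [hsum, Finset.sum_apply]
  exact Finset.sum_congr rfl fun s _ => hω s

end RandomState

section MaxAction

variable {S A : Type*}

theorem measurable_maxAction [Fintype A] [Nonempty A] {Ω : Type*} {m : MeasurableSpace Ω}
    {Q : Ω → S → A → ℝ} (hQ : ∀ s a, Measurable fun ω => Q ω s a) (s : S) :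
    Measurable fun ω => maxAction (Q ω) s := by
  have h := Finset.measurable_sup' Finset.univ_nonempty fun (a : A) _ => hQ s a
  convert h using 1
  funext ω
  simp only [maxAction, Finset.sup'_apply]

variable [Fintype S] [Fintype A]

theorem norm_apply_apply_le_norm {E : Type*} [SeminormedAddCommGroup E] (Q : S → A → E) (s : S)
    (a : A) : ‖Q s a‖ ≤ ‖Q‖ :=
  (norm_le_pi_norm (Q s) a).trans (norm_le_pi_norm Q s)

theorem norm_le_of_forall_norm_apply_apply_le {E : Type*} [SeminormedAddCommGroup E]
    {Q : S → A → E} {r : ℝ} (hr : 0 ≤ r) (h : ∀ s a, ‖Q s a‖ ≤ r) : ‖Q‖ ≤ r :=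
  (pi_norm_le_iff_of_nonneg hr).2 fun s => (pi_norm_le_iff_of_nonneg hr).2 fun a => h s a

variable [Nonempty A]

theorem maxAction_le_maxAction_add (Q₁ Q₂ : S → A → ℝ) (s : S) :
    maxAction Q₁ s ≤ maxAction Q₂ s + ‖Q₁ - Q₂‖ := by
  refine Finset.sup'_le _ _ fun a ha => ?_
  calc Q₁ s a = Q₂ s a + (Q₁ - Q₂) s a := (add_sub_cancel _ _).symm
    _ ≤ maxAction Q₂ s + ‖Q₁ - Q₂‖ :=
        add_le_add (Finset.le_sup' (fun a => Q₂ s a) ha)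
          ((le_abs_self _).trans (norm_apply_apply_le_norm (Q₁ - Q₂) s a))

theorem abs_maxAction_sub_le (Q₁ Q₂ : S → A → ℝ) (s : S) :
    |maxAction Q₁ s - maxAction Q₂ s| ≤ ‖Q₁ - Q₂‖ :=
  abs_sub_le_iff.2 ⟨sub_le_iff_le_add'.2 (maxAction_le_maxAction_add Q₁ Q₂ s),
    sub_le_iff_le_add'.2 (norm_sub_rev Q₁ Q₂ ▸ maxAction_le_maxAction_add Q₂ Q₁ s)⟩

theorem abs_maxAction_le (Q : S → A → ℝ) (s : S) : |maxAction Q s| ≤ ‖Q‖ := by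
  have hzero : maxAction (0 : S → A → ℝ) s = 0 := by simp [maxAction]
  simpa [hzero] using abs_maxAction_sub_le Q 0 s

end MaxAction

namespace FiniteMDP

variable {S A : Type*} [Fintype S]

theorem abs_sum_P_mul_le (M : FiniteMDP S A) (s : S) (a : A) {v : S → ℝ} {r : ℝ}
    (hv : ∀ s', |v s'| ≤ r) : |∑ s', M.P s a s' * v s'| ≤ r := by
  calc |∑ s', M.P s a s' * v s'| ≤ ∑ s', |M.P s a s' * v s'| := Finset.abs_sum_le_sum_abs _ _
    _ ≤ ∑ s', M.P s a s' * r := Finset.sum_le_sum fun s' _ => by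
        rw [abs_mul, abs_of_nonneg (M.P_nonneg s a s')]
        exact mul_le_mul_of_nonneg_left (hv s') (M.P_nonneg s a s')
    _ = r := by rw [← Finset.sum_mul, M.P_sum_eq_one, one_mul]

open Classical in
/-- The deterministic process with the rewards of `M` that moves from `(s, a)` to `x s a`. Its exact
Bellman update is the sampled update of `M` at the observed next states `x`. -/
noncomputable def observed (M : FiniteMDP S A) (x : S → A → S) : FiniteMDP S A where
  P s a s' := if s' = x s a then 1 else 0
  P_nonneg s a s' := by split_ifs <;> norm_num
  P_sum_eq_one s a := by simp
  R := M.R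

theorem bellman_observed [Fintype A] [Nonempty A] (M : FiniteMDP S A) (x : S → A → S) (γ : ℝ)
    (Q : S → A → ℝ) (s : S) (a : A) :
    bellman (M.observed x) γ Q s a = M.R s a + γ * maxAction Q (x s a) := by
  classical
  simp [bellman, observed, Finset.sum_ite_eq']

end FiniteMDP

section RegBellman

variable {S A : Type*} [Fintype S] [Fintype A] [Nonempty A] (M : FiniteMDP S A) {γ lam : ℝ}
  (Qmeta : S → A → ℝ)

theorem one_add_pos_of_abs_lt (hγ : |γ| < 1 + lam) : 0 < 1 + lam :=
  (abs_nonneg γ).trans_lt hγ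

theorem norm_regBellman_sub_le (hlam : 0 ≤ 1 + lam) (Q₁ Q₂ : S → A → ℝ) :
    ‖regBellman M γ lam Qmeta Q₁ - regBellman M γ lam Qmeta Q₂‖
      ≤ |γ| / (1 + lam) * ‖Q₁ - Q₂‖ := by
  refine norm_le_of_forall_norm_apply_apply_le (by positivity) fun s a => ?_
  have hdiff : (regBellman M γ lam Qmeta Q₁ - regBellman M γ lam Qmeta Q₂) s a =
      γ / (1 + lam) * ∑ s', M.P s a s' * (maxAction Q₁ s' - maxAction Q₂ s') := by
    simp only [Pi.sub_apply, regBellman, bellman, mul_sub, Finset.sum_sub_distrib]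
    ring
  rw [hdiff, norm_mul, norm_div, Real.norm_of_nonneg hlam]
  exact mul_le_mul_of_nonneg_left (M.abs_sum_P_mul_le s a (abs_maxAction_sub_le Q₁ Q₂))
    (by positivity)

theorem norm_regBellman_le (hlam : 0 ≤ 1 + lam) (Q : S → A → ℝ) :
    ‖regBellman M γ lam Qmeta Q‖ ≤ ‖regBellman M γ lam Qmeta 0‖ + |γ| / (1 + lam) * ‖Q‖ := by
  simpa using (norm_le_norm_add_norm_sub' _ (regBellman M γ lam Qmeta 0)).trans
    (add_le_add_right (norm_regBellman_sub_le M Qmeta hlam Q 0) _)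

theorem contractingWith_regBellman (hγ : |γ| < 1 + lam) :
    ContractingWith (|γ| / (1 + lam)).toNNReal (regBellman M γ lam Qmeta) := by
  have hlam := one_add_pos_of_abs_lt hγ
  refine ⟨Real.toNNReal_lt_one.2 ((div_lt_one hlam).2 hγ),
    LipschitzWith.of_dist_le' fun Q₁ Q₂ => ?_⟩
  simpa only [dist_eq_norm] using norm_regBellman_sub_le M Qmeta hlam.le Q₁ Q₂

theorem regBellman_observed_zero (x : S → A → S) :
    regBellman (M.observed x) γ lam Qmeta 0 = regBellman M γ lam Qmeta 0 := by
  funext s a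
  simp only [regBellman, FiniteMDP.bellman_observed]
  simp [bellman, maxAction]

theorem regBellman_observed_sub_apply (Q : S → A → ℝ) (x : S → A → S) (s : S) (a : A) :
    (regBellman (M.observed x) γ lam Qmeta Q - regBellman M γ lam Qmeta Q) s a =
      γ / (1 + lam) * (maxAction Q (x s a) - ∑ s', M.P s a s' * maxAction Q s') := by
  simp only [Pi.sub_apply, regBellman, FiniteMDP.bellman_observed]
  simp only [bellman]
  ring

theorem personalized_step_eq_relaxation (hlam : 1 + lam ≠ 0) (t : ℝ) (Q : S → A → ℝ) (s : S)
    (a : A) :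
    Q s a + t * (bellman M γ Q s a - Q s a) - t * lam / 2 * penaltyGrad Q Qmeta s a =
      (Q + ((1 + lam) * t) • (regBellman M γ lam Qmeta Q - Q)) s a := by
  simp only [penaltyGrad, regBellman, Pi.add_apply, Pi.sub_apply, Pi.smul_apply, smul_eq_mul]
  field_simp
  ring

variable (η : ℕ → ℝ) (Q₀ : S → A → ℝ)

theorem exactQ_succ (hlam : 1 + lam ≠ 0) (k : ℕ) :
    exactQ M γ lam η Qmeta Q₀ (k + 1) = exactQ M γ lam η Qmeta Q₀ k + ((1 + lam) * η k) •
      (regBellman M γ lam Qmeta (exactQ M γ lam η Qmeta Q₀ k) - exactQ M γ lam η Qmeta Q₀ k) := by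
  funext s a
  exact personalized_step_eq_relaxation M Qmeta hlam (η k) _ s a

theorem sampledQ_succ (hlam : 1 + lam ≠ 0) (x : ℕ → S → A → S) (k : ℕ) :
    sampledQ M γ lam η Qmeta Q₀ x (k + 1) = sampledQ M γ lam η Qmeta Q₀ x k + ((1 + lam) * η k) •
      (regBellman (M.observed (x k)) γ lam Qmeta (sampledQ M γ lam η Qmeta Q₀ x k)
        - sampledQ M γ lam η Qmeta Q₀ x k) := by
  funext s a
  rw [← personalized_step_eq_relaxation _ Qmeta hlam, FiniteMDP.bellman_observed, sampledQ]

variable {η}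

theorem exists_forall_norm_sampledQ_le (hγ : |γ| < 1 + lam) (hη₀ : ∀ k, 0 ≤ η k)
    (hη₂ : Summable fun k => η k ^ 2) :
    ∃ B, ∀ x k, ‖sampledQ M γ lam η Qmeta Q₀ x k‖ ≤ B := by
  have hlam := one_add_pos_of_abs_lt hγ
  have hα₀ : ∀ k, 0 ≤ (1 + lam) * η k := fun k => mul_nonneg hlam.le (hη₀ k)
  have hα₂ : Summable fun k => ((1 + lam) * η k) ^ 2 := by
    simpa only [mul_pow] using hη₂.mul_left ((1 + lam) ^ 2)
  refine ⟨max ‖Q₀‖ (‖regBellman M γ lam Qmeta 0‖ / (1 - |γ| / (1 + lam))) *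
    Real.exp (∑' k, ((1 + lam) * η k) ^ 2), fun x k => ?_⟩
  refine (le_max_mul_exp_sum_sq (y := fun k => ‖sampledQ M γ lam η Qmeta Q₀ x k‖)
    (C := ‖regBellman M γ lam Qmeta 0‖) (fun _ => norm_nonneg _) hα₀
    (by positivity) ((div_lt_one hlam).2 hγ) (fun k => ?_) k).trans ?_
  · have hG := norm_regBellman_le (γ := γ) (M.observed (x k)) Qmeta hlam.le
      (sampledQ M γ lam η Qmeta Q₀ x k)
    rw [regBellman_observed_zero] at hG
    rw [sampledQ_succ M Qmeta η Q₀ hlam.ne']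
    refine (norm_add_smul_sub_le _ _ _).trans ?_
    rw [abs_of_nonneg (hα₀ k)]
    gcongr
    exact hα₀ k
  · gcongr
    · rfl
    · exact hα₂.sum_le_tsum _ fun k _ => sq_nonneg _

theorem eventually_mul_le_one_of_summable_sq (hη₂ : Summable fun k => η k ^ 2) (c : ℝ) :
    ∀ᶠ k in atTop, c * η k ≤ 1 := by
  have hsq : Tendsto (fun k => (c * η k) ^ 2) atTop (𝓝 0) := by
    simpa [mul_pow] using hη₂.tendsto_atTop_zero.const_mul (c ^ 2)
  filter_upwards [hsq.eventually (gt_mem_nhds one_pos)] with k hk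
  exact le_of_abs_le (sq_le_one_iff_abs_le_one _ |>.1 hk.le)

theorem tendsto_of_relaxation_of_isFixedPt_regBellman (hγ : |γ| < 1 + lam)
    (hη₀ : ∀ k, 0 ≤ η k) (hη₁ : ¬ Summable η) (hη₂ : Summable fun k => η k ^ 2)
    {Qstar L : S → A → ℝ} (hQ : Function.IsFixedPt (regBellman M γ lam Qmeta) Qstar)
    {Y G : ℕ → S → A → ℝ} (hY : ∀ k, Y (k + 1) = Y k + ((1 + lam) * η k) • (G k - Y k))
    (hnoise : Tendsto (fun n => ∑ k ∈ Finset.range n,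
      ((1 + lam) * η k) • (G k - regBellman M γ lam Qmeta (Y k))) atTop (𝓝 L)) :
    Tendsto Y atTop (𝓝 Qstar) := by
  have hlam := one_add_pos_of_abs_lt hγ
  have hF : ∀ Q, ‖regBellman M γ lam Qmeta Q - Qstar‖ ≤ |γ| / (1 + lam) * ‖Q - Qstar‖ :=
    fun Q => by simpa only [hQ.eq] using norm_regBellman_sub_le (γ := γ) M Qmeta hlam.le Q Qstar
  exact tendsto_of_relaxation_of_contracting (by positivity) ((div_lt_one hlam).2 hγ) hF
    (fun k => mul_nonneg hlam.le (hη₀ k)) (eventually_mul_le_one_of_summable_sq hη₂ _)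
    ((summable_mul_left_iff hlam.ne').not.2 hη₁) hY hnoise

theorem tendsto_exactQ (hγ : |γ| < 1 + lam) (hη₀ : ∀ k, 0 ≤ η k) (hη₁ : ¬ Summable η)
    (hη₂ : Summable fun k => η k ^ 2) {Qstar : S → A → ℝ}
    (hQ : Function.IsFixedPt (regBellman M γ lam Qmeta) Qstar) :
    Tendsto (exactQ M γ lam η Qmeta Q₀) atTop (𝓝 Qstar) :=
  tendsto_of_relaxation_of_isFixedPt_regBellman M Qmeta hγ hη₀ hη₁ hη₂ (L := 0) hQ
    (exactQ_succ M Qmeta η Q₀ (one_add_pos_of_abs_lt hγ).ne') (by simp)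

end RegBellman

namespace IsTransitionSampling

variable {Ω S A : Type*} {mΩ : MeasurableSpace Ω} {μ : Measure Ω} {ℱ : Filtration ℕ mΩ}
  [Fintype S] {M : FiniteMDP S A} {X : ℕ → Ω → S → A → S}

theorem measurable_apply (hX : IsTransitionSampling μ ℱ M X) {k : ℕ} {V : Ω → S → ℝ}
    (hV : ∀ s', Measurable[ℱ k] fun ω => V ω s') (s : S) (a : A) :
    Measurable[ℱ (k + 1)] fun ω => V ω (X k ω s a) :=
  measurable_apply_of_measurableSet_fiber (hX.measurable k s a) fun s' =>
    (hV s').mono (ℱ.mono k.le_succ) le_rfl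

theorem condExp_mul_apply_sub_eq_zero [IsFiniteMeasure μ] (hX : IsTransitionSampling μ ℱ M X)
    {k : ℕ} {V : Ω → S → ℝ} (hV : ∀ s', Measurable[ℱ k] fun ω => V ω s') {B : ℝ}
    (hB : ∀ ω s', |V ω s'| ≤ B) (b : ℝ) (s : S) (a : A) :
    μ[fun ω => b * (V ω (X k ω s a) - ∑ s', M.P s a s' * V ω s') | ℱ k] =ᵐ[μ] 0 := by
  set W : Ω → ℝ := fun ω => V ω (X k ω s a)
  set e : Ω → ℝ := fun ω => ∑ s', M.P s a s' * V ω s'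
  have he : Measurable[ℱ k] e := Finset.measurable_fun_sum _ fun s' _ => (hV s').const_mul _
  have hei : Integrable e μ := .of_bound (he.mono (ℱ.le k) le_rfl).aestronglyMeasurable B
    (.of_forall fun ω => M.abs_sum_P_mul_le s a (hB ω))
  have hWi : Integrable W μ :=
    .of_bound ((hX.measurable_apply hV s a).mono (ℱ.le _) le_rfl).aestronglyMeasurable B
      (.of_forall fun ω => hB ω _)
  have hW : μ[W | ℱ k] =ᵐ[μ] e :=
    condExp_apply_of_condExp_indicator (fun s' => ℱ.le _ _ (hX.measurable k s a s'))
      (hX.law k s a) (fun s' => (hV s').stronglyMeasurable) fun s' =>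
      .of_bound ((hV s').mono (ℱ.le k) le_rfl).aestronglyMeasurable B
        (.of_forall fun ω => hB ω s')
  filter_upwards [condExp_smul b (W - e) (ℱ k), condExp_sub hWi hei (ℱ k), hW]
    with ω hsmul hsub hWe
  rw [show (fun ω => b * (W ω - e ω)) = b • (W - e) from rfl, hsmul, Pi.smul_apply, hsub,
    Pi.sub_apply, hWe, condExp_of_stronglyMeasurable (ℱ.le k) he.stronglyMeasurable hei, sub_self,
    smul_zero, Pi.zero_apply]

theorem ae_exists_tendsto_sum_mul_apply_sub [IsFiniteMeasure μ]
    (hX : IsTransitionSampling μ ℱ M X) {V : ℕ → Ω → S → ℝ}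
    (hV : ∀ k s', Measurable[ℱ k] fun ω => V k ω s') {B : ℝ} (hB : ∀ k ω s', |V k ω s'| ≤ B)
    {b : ℕ → ℝ} (hb : Summable fun k => b k ^ 2) (s : S) (a : A) :
    ∀ᵐ ω ∂μ, ∃ l, Tendsto (fun n => ∑ k ∈ Finset.range n,
      b k * (V k ω (X k ω s a) - ∑ s', M.P s a s' * V k ω s')) atTop (𝓝 l) := by
  set d : ℕ → Ω → ℝ := fun k ω => b k * (V k ω (X k ω s a) - ∑ s', M.P s a s' * V k ω s')
  have hd : ∀ k, StronglyMeasurable[ℱ (k + 1)] (d k) := fun k =>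
    (((hX.measurable_apply (hV k) s a).sub (Finset.measurable_fun_sum _ fun s' _ =>
      ((hV k s').mono (ℱ.mono k.le_succ) le_rfl).const_mul _)).const_mul _).stronglyMeasurable
  have hdB : ∀ k ω, |d k ω| ≤ |b k| * (B + B) := fun k ω => by
    rw [abs_mul]
    exact mul_le_mul_of_nonneg_left ((abs_sub _ _).trans
      (add_le_add (hB k ω _) (M.abs_sum_P_mul_le s a (hB k ω)))) (abs_nonneg _)
  have hd2 : ∀ k, MemLp (d k) 2 μ := fun k =>
    .of_bound ((hd k).mono (ℱ.le _)).aestronglyMeasurable _ (.of_forall (hdB k))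
  refine ae_exists_tendsto_sum_of_condExp_eq_zero hd hd2 ?_ fun k =>
    hX.condExp_mul_apply_sub_eq_zero (hV k) (hB k) (b k) s a
  refine .of_nonneg_of_le (fun k => integral_nonneg fun ω => sq_nonneg _) (fun k => ?_)
    (hb.mul_right ((B + B) ^ 2 * μ.real Set.univ))
  calc ∫ ω, d k ω ^ 2 ∂μ ≤ ∫ _, (|b k| * (B + B)) ^ 2 ∂μ :=
        integral_mono (hd2 k).integrable_sq (integrable_const _) fun ω =>
          sq_le_sq.2 ((hdB k ω).trans (le_abs_self _))
    _ = b k ^ 2 * ((B + B) ^ 2 * μ.real Set.univ) := by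
        rw [integral_const, smul_eq_mul, mul_pow, sq_abs]
        ring

variable [Fintype A] [Nonempty A]

theorem measurable_sampledQ (hX : IsTransitionSampling μ ℱ M X) (γ lam : ℝ) (η : ℕ → ℝ)
    (Qmeta Q₀ : S → A → ℝ) (k : ℕ) (s : S) (a : A) :
    Measurable[ℱ k] fun ω => sampledQ M γ lam η Qmeta Q₀ (fun j => X j ω) k s a := by
  induction k generalizing s a with
  | zero => exact measurable_const
  | succ k ih =>
    have hmax := hX.measurable_apply (fun s' => measurable_maxAction ih s') s a
    have hQ := (ih s a).mono (ℱ.mono k.le_succ) le_rfl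
    simp only [sampledQ, penaltyGrad]
    exact (hQ.add (((hmax.const_mul γ).const_add _ |>.sub hQ).const_mul _)).sub
      (((hQ.sub_const _).const_mul 2).const_mul _)

theorem ae_tendsto_sampledQ [IsFiniteMeasure μ] (hX : IsTransitionSampling μ ℱ M X) {γ lam : ℝ}
    (hγ : |γ| < 1 + lam) {η : ℕ → ℝ} (hη₀ : ∀ k, 0 ≤ η k) (hη₁ : ¬ Summable η)
    (hη₂ : Summable fun k => η k ^ 2) (Qmeta Q₀ : S → A → ℝ) {Qstar : S → A → ℝ}
    (hQ : Function.IsFixedPt (regBellman M γ lam Qmeta) Qstar) :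
    ∀ᵐ ω ∂μ, Tendsto (sampledQ M γ lam η Qmeta Q₀ fun j => X j ω) atTop (𝓝 Qstar) := by
  set Q : ℕ → Ω → S → A → ℝ := fun k ω => sampledQ M γ lam η Qmeta Q₀ (fun j => X j ω) k
  obtain ⟨B, hB⟩ := exists_forall_norm_sampledQ_le M Qmeta Q₀ hγ hη₀ hη₂
  have hb : Summable fun k => ((1 + lam) * η k * (γ / (1 + lam))) ^ 2 := by
    simpa only [mul_pow] using (hη₂.mul_left _).mul_right _
  have hnoise : ∀ s a, ∀ᵐ ω ∂μ, ∃ l, Tendsto (fun n => ∑ k ∈ Finset.range n,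
      (1 + lam) * η k * (γ / (1 + lam)) * (maxAction (Q k ω) (X k ω s a)
        - ∑ s', M.P s a s' * maxAction (Q k ω) s')) atTop (𝓝 l) :=
    hX.ae_exists_tendsto_sum_mul_apply_sub
      (fun k s' => measurable_maxAction (hX.measurable_sampledQ γ lam η Qmeta Q₀ k) s')
      (fun k ω s' => (abs_maxAction_le _ s').trans (hB _ k)) hb
  filter_upwards [ae_all_iff.2 fun s => ae_all_iff.2 (hnoise s)] with ω hω
  choose L hL using hω
  refine tendsto_of_relaxation_of_isFixedPt_regBellman M Qmeta hγ hη₀ hη₁ hη₂ (L := L) hQ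
    (sampledQ_succ M Qmeta η Q₀ (one_add_pos_of_abs_lt hγ).ne' fun j => X j ω)
    (tendsto_pi_nhds.2 fun s => tendsto_pi_nhds.2 fun a => ?_)
  simpa only [Finset.sum_apply, Pi.smul_apply, smul_eq_mul, regBellman_observed_sub_apply,
    mul_assoc] using hL s a

end IsTransitionSampling

theorem theorem1_general {ι : Type*} [Finite ι] {S : ι → Type*} {A : ι → Type*}
    [∀ i, Fintype (S i)] [∀ i, Fintype (A i)] [∀ i, Nonempty (A i)]
    (M : ∀ i, FiniteMDP (S i) (A i)) (γ lam : ℝ) (hγ : |γ| < 1 + lam)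
    (η : ℕ → ℝ) (hη₀ : ∀ k, 0 ≤ η k) (hη₁ : ¬ Summable η) (hη₂ : Summable fun k => η k ^ 2)
    (Qmeta : ∀ i, S i → A i → ℝ) (Q₀ Qs₀ : ∀ i, S i → A i → ℝ)
    {Ω : Type*} {mΩ : MeasurableSpace Ω} (μ : Measure Ω) [IsFiniteMeasure μ]
    (ℱ : Filtration ℕ mΩ) (X : ∀ i, ℕ → Ω → S i → A i → S i)
    (hX : ∀ i, IsTransitionSampling μ ℱ (M i) (X i)) :
    (∀ i, ∀ Q₁ Q₂ : S i → A i → ℝ,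
      ‖regBellman (M i) γ lam (Qmeta i) Q₁ - regBellman (M i) γ lam (Qmeta i) Q₂‖
        ≤ |γ| / (1 + lam) * ‖Q₁ - Q₂‖) ∧
    (∃ Qstar : ∀ i, S i → A i → ℝ,
      (∀ i, ∀ Q, Function.IsFixedPt (regBellman (M i) γ lam (Qmeta i)) Q ↔ Q = Qstar i) ∧
      ∀ᵐ ω ∂μ, ∀ i,
        Tendsto (fun k => sampledQ (M i) γ lam η (Qmeta i) (Qs₀ i) (fun j => X i j ω) k)
          atTop (𝓝 (Qstar i))) ∧
    (∀ᵐ ω ∂μ, ∀ δ : ℝ, 0 < δ → ∃ K₀ : ℕ, ∀ K, K₀ ≤ K → ∀ i s a,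
      |exactQ (M i) γ lam η (Qmeta i) (Q₀ i) K s a
        - sampledQ (M i) γ lam η (Qmeta i) (Qs₀ i) (fun j => X i j ω) K s a| ≤ δ) := by
  have hcontr := fun i => contractingWith_regBellman (M i) (Qmeta i) hγ
  set Qstar : ∀ i, S i → A i → ℝ := fun i => (hcontr i).fixedPoint
  have hfix : ∀ i, Function.IsFixedPt (regBellman (M i) γ lam (Qmeta i)) (Qstar i) :=
    fun i => (hcontr i).fixedPoint_isFixedPt
  have hsampled : ∀ᵐ ω ∂μ, ∀ i,
      Tendsto (sampledQ (M i) γ lam η (Qmeta i) (Qs₀ i) fun j => X i j ω) atTop (𝓝 (Qstar i)) :=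
    ae_all_iff.2 fun i => (hX i).ae_tendsto_sampledQ hγ hη₀ hη₁ hη₂ (Qmeta i) (Qs₀ i) (hfix i)
  refine ⟨fun i => norm_regBellman_sub_le (M i) (Qmeta i) (one_add_pos_of_abs_lt hγ).le,
    ⟨Qstar, fun i Q => ⟨(hcontr i).fixedPoint_unique, fun h => h ▸ hfix i⟩, hsampled⟩, ?_⟩
  filter_upwards [hsampled] with ω hω δ hδ
  have hdiff : ∀ i, Tendsto (fun k => exactQ (M i) γ lam η (Qmeta i) (Q₀ i) k
      - sampledQ (M i) γ lam η (Qmeta i) (Qs₀ i) (fun j => X i j ω) k) atTop (𝓝 0) := fun i => by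
    simpa using (tendsto_exactQ (M i) (Qmeta i) (Q₀ i) hγ hη₀ hη₁ hη₂ (hfix i)).sub (hω i)
  obtain ⟨K₀, hK₀⟩ := eventually_atTop.1 <| eventually_all.2 fun i =>
    (tendsto_zero_iff_norm_tendsto_zero.1 (hdiff i)).eventually (ge_mem_nhds hδ)
  exact ⟨K₀, fun K hK i s a => (norm_apply_apply_le_norm _ s a).trans (hK₀ K hK i)⟩

theorem theorem1 {N : ℕ} {S : Fin N → Type*} {A : Fin N → Type*}
    [∀ i, Fintype (S i)] [∀ i, Fintype (A i)] [∀ i, Nonempty (A i)]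
    (M : ∀ i, FiniteMDP (S i) (A i))
    (γ lam : ℝ) (hγ₀ : 0 ≤ γ) (hγ₁ : γ < 1) (hlam : 0 ≤ lam)
    (η : ℕ → ℝ) (hη₀ : ∀ k, 0 ≤ η k) (hη₁ : ¬ Summable η) (hη₂ : Summable fun k => η k ^ 2)
    (Qmeta : ∀ i, S i → A i → ℝ) (Q₀ Qs₀ : ∀ i, S i → A i → ℝ)
    {Ω : Type*} {mΩ : MeasurableSpace Ω} (μ : Measure Ω) [IsProbabilityMeasure μ]
    (ℱ : Filtration ℕ mΩ)
    (X : ∀ i, ℕ → Ω → S i → A i → S i)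
    (hX : ∀ i, IsTransitionSampling μ ℱ (M i) (X i)) :
    (∀ i, ∀ Q₁ Q₂ : S i → A i → ℝ,
      ‖regBellman (M i) γ lam (Qmeta i) Q₁ - regBellman (M i) γ lam (Qmeta i) Q₂‖
        ≤ γ / (1 + lam) * ‖Q₁ - Q₂‖) ∧
    (∃ Qstar : ∀ i, S i → A i → ℝ,
      (∀ i, ∀ Q, Function.IsFixedPt (regBellman (M i) γ lam (Qmeta i)) Q ↔ Q = Qstar i) ∧
      ∀ᵐ ω ∂μ, ∀ i,
        Tendsto (fun k => sampledQ (M i) γ lam η (Qmeta i) (Qs₀ i) (fun j => X i j ω) k)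
          atTop (𝓝 (Qstar i))) ∧
    (∀ᵐ ω ∂μ, ∀ δ : ℝ, 0 < δ → ∃ K₀ : ℕ, ∀ K, K₀ ≤ K → ∀ i s a,
      |exactQ (M i) γ lam η (Qmeta i) (Q₀ i) K s a
        - sampledQ (M i) γ lam η (Qmeta i) (Qs₀ i) (fun j => X i j ω) K s a| ≤ δ) := by
  simpa only [abs_of_nonneg hγ₀] using theorem1_general M γ lam
    (by rw [abs_of_nonneg hγ₀]; linarith) η hη₀ hη₁ hη₂ Qmeta Q₀ Qs₀ μ ℱ X hX
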